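/- Let $C$ be an integral domain of characteristic zero and let $\lambda\in C$. For a commutative unital $C$-algebra $A$, let $Ш_C(A)=Ш_{C,\lambda}(A)=\bigoplus_{k\ge 0}A^{\otimes_C (k+1)}=A\otimes_C\bigoplus_{k\ge 0}A^{\otimes_C k}$ be the free (shuffle) Baxter $C$-algebra of weight $\lambda$ on $A$, with the product $(x_0\otimes x^+)(y_0\otimes y^+)=x_0y_0\otimes(x^+\star y^+)$. Here $\star$ is the mixable shuffle product of weight $\lambda$: the $C$-bilinear product on $\bigoplus_{k\ge0}A^{\otimes k}$ with unit $1\in A^{\otimes 0}=C$ and $$(a\otimes s)\star(b\otimes t)=a\otimes\bigl(s\star(b\otimes t)\bigr)+b\otimes\bigl((a\otimes s)\star t\bigr)+\lambda\,ab\otimes(s\star t).$$ For a set $X$ put $Ш_C(X)=Ш_C(C[X])$, where $C[X]$ is the polynomial algebra on $X$. 1. If $A$ is a $C$-algebra that is an integral domain and is flat as a $C$-module, then $Ш_C(A)$ is an integral domain. In particular, $Ш_C(X)$ is an integral domain for every set $X$. 2. Suppose that $C$ is a Dedekind domain, and let $A$ be a commutative $C$-algebra whose structure map $C\to A$ is injective.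 Then $Ш_C(A)$ is an integral domain if and only if $A$ is an integral domain and is torsion-free as a $C$-module. -/

import Mathlib

open scoped TensorProduct

namespace ShuffleBaxter

noncomputable section

section Product

variable {C : Type*} [CommRing C] {A : Type*} [CommRing A] [Algebra C A]

/-- Prepending a tensor factor, `a, t ↦ a ⊗ t`, on `T(A) = ⨁ₙ A^{⊗ n}`. -/
def cons : A →ₗ[C] TensorAlgebra C A →ₗ[C] TensorAlgebra C A :=
  (LinearMap.mul C (TensorAlgebra C A)).comp (TensorAlgebra.ι C)

theorem cons_apply (a : A) (t : TensorAlgebra C A) :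
    cons a t = TensorAlgebra.ι C a * t := rfl

theorem word_induction {p : TensorAlgebra C A → Prop} (one : p 1)
    (add : ∀ s t, p s → p t → p (s + t)) (smul : ∀ (c : C) t, p t → p (c • t))
    (hcons : ∀ a t, p t → p (cons a t)) (t : TensorAlgebra C A) : p t := by
  suffices h : ∀ s t : TensorAlgebra C A, p t → p (s * t) by simpa using h t 1 one
  intro s
  induction s using TensorAlgebra.induction with
  | algebraMap r => intro t ht; rw [← Algebra.smul_def]; exact smul r t ht
  | ι a => intro t ht; exact hcons a t ht
  | mul x y hx hy => intro t ht; rw [mul_assoc]; exact hx _ (hy _ ht)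
  | add x y hx hy => intro t ht; rw [add_mul]; exact add _ _ (hx _ ht) (hy _ ht)

theorem linearMap_ext {M : Type*} [AddCommGroup M] [Module C M]
    {f g : TensorAlgebra C A →ₗ[C] M} (one : f 1 = g 1)
    (hcons : ∀ a t, f t = g t → f (cons a t) = g (cons a t)) : f = g := by
  ext t
  induction t using word_induction with
  | one => exact one
  | add s t hs ht => rw [map_add, map_add, hs, ht]
  | smul c t ht => rw [map_smul, map_smul, ht]
  | hcons a t ht => exact hcons a t ht

/-- Auxiliary: one step `(t, g) ↦ (b ⊗ t, b ⊗ g + a ⊗ f(b ⊗ t) + lam (ab ⊗ f(t)))`. -/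
def stepAux (lam : C) (a : A) (f : Module.End C (TensorAlgebra C A)) :
    A →ₗ[C] Module.End C (TensorAlgebra C A × TensorAlgebra C A) where
  toFun b := LinearMap.prod ((cons b).comp (LinearMap.fst C _ _))
    ((cons b).comp (LinearMap.snd C _ _) +
      ((cons a).comp (f.comp (cons b)) + lam • (cons (a * b)).comp f).comp (LinearMap.fst C _ _))
  map_add' b c := by
    ext x <;> simp [mul_add, map_add, smul_add]
    abel
  map_smul' r b := by
    ext x <;> simp [smul_add, smul_comm lam r]

theorem stepAux_apply (lam : C) (a : A) (f : Module.End C (TensorAlgebra C A)) (b : A)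
    (p : TensorAlgebra C A × TensorAlgebra C A) :
    stepAux lam a f b p =
      (cons b p.1, cons b p.2 + (cons a (f (cons b p.1)) + lam • cons (a * b) (f p.1))) := rfl

/-- Auxiliary: the endomorphism `g` with `g(1) = a ⊗ f(1)` and
`g(b ⊗ t) = a ⊗ f(b ⊗ t) + b ⊗ g(t) + lam (ab ⊗ f(t))`. -/
def stepFun (lam : C) (a : A) (f : Module.End C (TensorAlgebra C A)) :
    Module.End C (TensorAlgebra C A) :=
  (LinearMap.snd C _ _).comp
    ((LinearMap.applyₗ ((1 : TensorAlgebra C A), cons a (f 1))).comp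
      (TensorAlgebra.lift C (stepAux lam a f)).toLinearMap)

theorem stepFun_one (lam : C) (a : A) (f : Module.End C (TensorAlgebra C A)) :
    stepFun lam a f 1 = cons a (f 1) := by
  simp [stepFun]

theorem stepFun_cons (lam : C) (a : A) (f : Module.End C (TensorAlgebra C A)) (b : A)
    (t : TensorAlgebra C A) :
    stepFun lam a f (cons b t) =
      cons a (f (cons b t)) + cons b (stepFun lam a f t) + lam • cons (a * b) (f t) := by
  have key : ∀ t : TensorAlgebra C A,
      (TensorAlgebra.lift C (stepAux lam a f) t ((1 : TensorAlgebra C A), cons a (f 1))).1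
        = t := by
    intro t
    induction t using word_induction with
    | one => simp
    | add s t hs ht => simp [map_add, hs, ht]
    | smul c t ht => simp [ht]
    | hcons b t ht =>
      rw [cons_apply, map_mul, Module.End.mul_apply, TensorAlgebra.lift_ι_apply, stepAux_apply,
        ht, cons_apply]
  simp only [stepFun, LinearMap.comp_apply, AlgHom.toLinearMap_apply, LinearMap.applyₗ_apply_apply,
    LinearMap.snd_apply]
  rw [cons_apply b t, map_mul, Module.End.mul_apply, TensorAlgebra.lift_ι_apply, stepAux_apply,
    key, ← cons_apply b t, ← add_assoc, add_comm (cons b _)]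

/-- Left multiplication by `a ⊗ s` in terms of left multiplication `f` by `s`. -/
def step (lam : C) : A →ₗ[C] Module.End C (Module.End C (TensorAlgebra C A)) where
  toFun a :=
    { toFun := stepFun lam a
      map_add' := fun f g => by
        refine linearMap_ext ?_ fun b t h => ?_
        · simp [stepFun_one]
        · simp only [LinearMap.add_apply, stepFun_cons] at h ⊢
          rw [h]; simp only [map_add, smul_add]; abel
      map_smul' := fun r f => by
        refine linearMap_ext ?_ fun b t h => ?_
        · simp [stepFun_one]
        · simp only [LinearMap.smul_apply, stepFun_cons, RingHom.id_apply] at h ⊢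
          rw [h]; simp only [map_smul, smul_add, smul_comm lam r] }
  map_add' a a' := by
    ext1 f
    refine linearMap_ext ?_ fun b t h => ?_
    · simp [stepFun_one]
    · simp only [LinearMap.add_apply, stepFun_cons, LinearMap.coe_mk, AddHom.coe_mk] at h ⊢
      rw [h]; simp only [map_add, smul_add, add_mul, LinearMap.add_apply]; abel
  map_smul' r a := by
    ext1 f
    refine linearMap_ext ?_ fun b t h => ?_
    · simp [stepFun_one]
    · simp only [LinearMap.smul_apply, stepFun_cons, RingHom.id_apply, LinearMap.coe_mk,
        AddHom.coe_mk] at h ⊢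
      rw [h]; simp only [map_smul, smul_add, smul_comm lam r, LinearMap.smul_apply,
        smul_mul_assoc]

/-- The mixable shuffle product of weight `lam` on `T(A) = ⨁ₙ A^{⊗ n}`. -/
def mixMul (lam : C) : TensorAlgebra C A →ₗ[C] TensorAlgebra C A →ₗ[C] TensorAlgebra C A :=
  (LinearMap.applyₗ (LinearMap.id : Module.End C (TensorAlgebra C A))).comp
    (TensorAlgebra.lift C (step lam)).toLinearMap

theorem mixMul_one_left (lam : C) (t : TensorAlgebra C A) : mixMul lam 1 t = t := by
  simp [mixMul]

theorem mixMul_cons (lam : C) (a : A) (s : TensorAlgebra C A) :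
    mixMul lam (cons a s) = stepFun lam a (mixMul lam s) := by
  simp [mixMul, cons_apply, step]

theorem mixMul_one_right (lam : C) (s : TensorAlgebra C A) : mixMul lam s 1 = s := by
  induction s using word_induction with
  | one => exact mixMul_one_left lam 1
  | add s t hs ht => simp [hs, ht]
  | smul c t ht => simp [ht]
  | hcons a t ht => rw [mixMul_cons, stepFun_one, ht]

theorem mixMul_cons_cons (lam : C) (a b : A) (s t : TensorAlgebra C A) :
    mixMul lam (cons a s) (cons b t) =
      cons a (mixMul lam s (cons b t)) + cons b (mixMul lam (cons a s) t)
        + lam • cons (a * b) (mixMul lam s t) := by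
  rw [mixMul_cons, stepFun_cons]

theorem mixMul_comm (lam : C) (s t : TensorAlgebra C A) : mixMul lam s t = mixMul lam t s := by
  induction s using word_induction generalizing t with
  | one => rw [mixMul_one_left, mixMul_one_right]
  | add s s' hs hs' => simp [hs, hs']
  | smul c s hs => simp [hs]
  | hcons a s hs =>
    induction t using word_induction with
    | one => rw [mixMul_one_left, mixMul_one_right]
    | add t t' ht ht' => simp [ht, ht']
    | smul c t ht => simp [ht]
    | hcons b t ht =>
      rw [mixMul_cons_cons, mixMul_cons_cons, ht, hs, hs, mul_comm a b]
      abel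

theorem mixMul_assoc (lam : C) (s t u : TensorAlgebra C A) :
    mixMul lam (mixMul lam s t) u = mixMul lam s (mixMul lam t u) := by
  induction s using word_induction generalizing t u with
  | one => simp [mixMul_one_left]
  | add s s' hs hs' => simp [hs, hs']
  | smul c s hs => simp [hs]
  | hcons a s hs =>
    induction t using word_induction generalizing u with
    | one => simp [mixMul_one_left, mixMul_one_right]
    | add t t' ht ht' => simp [ht, ht']
    | smul c t ht => simp [ht]
    | hcons b t ht =>
      induction u using word_induction with
      | one => simp [mixMul_one_right]
      | add u u' hu hu' => simp [hu, hu']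
      | smul c u hu => simp [hu]
      | hcons c u hu =>
        have hu' := hu
        simp only [mixMul_cons_cons, map_add, map_smul, LinearMap.add_apply,
          LinearMap.smul_apply, smul_add, hs, ht, mul_assoc] at hu' ⊢
        have e : cons c (mixMul lam (cons a (mixMul lam s (cons b t))) u)
            + cons c (mixMul lam (cons b (mixMul lam (cons a s) t)) u)
            + lam • cons c (mixMul lam (cons (a * b) (mixMul lam s t)) u)
            = cons c (mixMul lam (cons a s) (mixMul lam (cons b t) u)) := by
          rw [← map_smul, ← map_add, ← map_add, hu']
        rw [← e, mul_left_comm a b c]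
        abel

end Product

/-- The `C`-module `T(A) = ⨁ₙ A^{⊗ n}` (Mathlib's tensor algebra, of which only the module
structure and the empty tensor `1` are kept), with the *mixable shuffle product* of weight `lam`:
the sum over all mixable shuffles `(σ, S)` of `x₁ ⊗ ⋯ ⊗ xₘ` and `y₁ ⊗ ⋯ ⊗ yₙ`, with coefficient
`lam ^ |S|`.  A mixable shuffle of `a ⊗ s` and `b ⊗ t` has first factor `a`, or `b`, or the merged
`ab` (weighted by `lam`), followed by a mixable shuffle of the remaining factors, so the product is
the bilinear one with unit `1` and
`(a ⊗ s) ⋆ (b ⊗ t) = a ⊗ (s ⋆ (b ⊗ t)) + b ⊗ ((a ⊗ s) ⋆ t) + lam (ab ⊗ (s ⋆ t))`;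
see `mixMul_one_left`, `mixMul_one_right`, `mixMul_cons_cons`. -/
def MixShuffle (C : Type*) [CommRing C] (_lam : C) (A : Type*) [CommRing A] [Algebra C A] :
    Type _ :=
  TensorAlgebra C A

section Sha

variable {C : Type*} [CommRing C] (lam : C) (A : Type*) [CommRing A] [Algebra C A]

instance : AddCommGroup (MixShuffle C lam A) := inferInstanceAs (AddCommGroup (TensorAlgebra C A))

instance : Module C (MixShuffle C lam A) := inferInstanceAs (Module C (TensorAlgebra C A))

instance : CommRing (MixShuffle C lam A) :=
  { (inferInstance : AddCommGroup (MixShuffle C lam A)) with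
    mul := fun s t => mixMul (C := C) (A := A) lam s t
    one := (1 : TensorAlgebra C A)
    left_distrib := fun s t u => map_add (mixMul (C := C) (A := A) lam s) t u
    right_distrib := fun s t u => LinearMap.map_add₂ (mixMul (C := C) (A := A) lam) s t u
    zero_mul := fun s => LinearMap.map_zero₂ (mixMul (C := C) (A := A) lam) s
    mul_zero := fun s => map_zero (mixMul (C := C) (A := A) lam s)
    mul_assoc := fun s t u => mixMul_assoc (C := C) (A := A) lam s t u
    one_mul := fun s => mixMul_one_left (C := C) (A := A) lam s
    mul_one := fun s => mixMul_one_right (C := C) (A := A) lam s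
    mul_comm := fun s t => mixMul_comm (C := C) (A := A) lam s t }

theorem MixShuffle.mul_def (s t : MixShuffle C lam A) :
    s * t = mixMul (C := C) (A := A) lam s t := rfl

instance : Algebra C (MixShuffle C lam A) :=
  Algebra.ofModule
    (fun r s t => LinearMap.map_smul₂ (mixMul (C := C) (A := A) lam) r s t)
    (fun r s t => map_smul (mixMul (C := C) (A := A) lam s) r t)

/-- The shuffle Baxter algebra `Ш_{C,lam}(A) = ⨁ₖ A^{⊗ (k+1)} = A ⊗ T(A)`, with the mixed shuffle
product `(x₀ ⊗ x⁺)(y₀ ⊗ y⁺) = x₀y₀ ⊗ (x⁺ ⋆ y⁺)`, where `⋆` is the mixable shuffle product of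
weight `lam`. -/
abbrev Sha : Type _ := A ⊗[C] MixShuffle C lam A

/-- Prepending a factor, as a map to `MixShuffle C lam A`. -/
def MixShuffle.cons : A →ₗ[C] MixShuffle C lam A →ₗ[C] MixShuffle C lam A :=
  ShuffleBaxter.cons (C := C) (A := A)

/-- The operator `P_A (x₀ ⊗ x₁ ⊗ ⋯ ⊗ xₙ) = 1 ⊗ x₀ ⊗ x₁ ⊗ ⋯ ⊗ xₙ` on `Ш_{C,lam}(A)`. -/
def shaOp : Sha lam A →ₗ[C] Sha lam A :=
  (TensorProduct.mk C A (MixShuffle C lam A) 1).comp (TensorProduct.lift (MixShuffle.cons lam A))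

variable {A}

/-- `P` is a Baxter operator of weight `lam`. -/
def IsBaxterOperator {R : Type*} [CommRing R] [Algebra C R] (P : R →ₗ[C] R) : Prop :=
  ∀ x y : R, P x * P y = P (x * P y) + P (y * P x) + lam • P (x * y)

theorem shaOp_tmul (a : A) (w : MixShuffle C lam A) :
    shaOp lam A (a ⊗ₜ w) = 1 ⊗ₜ MixShuffle.cons lam A a w := rfl

theorem MixShuffle.cons_mul_cons (a b : A) (s t : MixShuffle C lam A) :
    cons lam A a s * cons lam A b t =
      cons lam A a (s * cons lam A b t) + cons lam A b (t * cons lam A a s)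
        + lam • cons lam A (a * b) (s * t) := by
  rw [mul_comm t]
  exact mixMul_cons_cons lam a b s t

theorem MixShuffle.induction {p : MixShuffle C lam A → Prop} (one : p 1)
    (add : ∀ s t, p s → p t → p (s + t)) (smul : ∀ (c : C) t, p t → p (c • t))
    (hcons : ∀ a t, p t → p (cons lam A a t)) (t : MixShuffle C lam A) : p t :=
  word_induction (C := C) (A := A) one add smul hcons t

/-- `Ш_{C,lam}(A)` is a Baxter algebra of weight `lam`. -/
theorem isBaxterOperator_shaOp : IsBaxterOperator lam (shaOp lam A) := by
  intro x y
  induction x using TensorProduct.induction_on with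
  | zero => simp
  | add x x' hx hx' =>
    simp only [map_add, add_mul, mul_add, smul_add, hx, hx']; abel
  | tmul a s =>
    induction y using TensorProduct.induction_on with
    | zero => simp
    | add y y' hy hy' =>
      simp only [map_add, add_mul, mul_add, smul_add, hy, hy']; abel
    | tmul b t =>
      simp only [shaOp_tmul, Algebra.TensorProduct.tmul_mul_tmul, mul_one,
        MixShuffle.cons_mul_cons, TensorProduct.tmul_add, TensorProduct.tmul_smul]

/-- `Ш_{C,lam}(A)` is the free Baxter algebra of weight `lam` on `A`. -/
theorem sha_free {R : Type*} [CommRing R] [Algebra C R] (P : R →ₗ[C] R)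
    (hP : IsBaxterOperator lam P) (φ : A →ₐ[C] R) :
    ∃! f : Sha lam A →ₐ[C] R,
      (∀ x, f (shaOp lam A x) = P (f x)) ∧ ∀ a : A, f (a ⊗ₜ 1) = φ a := by
  let g : MixShuffle C lam A →ₗ[C] R :=
    (LinearMap.applyₗ (1 : R)).comp (TensorAlgebra.lift C
      ((LinearMap.llcomp C R R R P).comp ((LinearMap.mul C R).comp φ.toLinearMap))).toLinearMap
  have g_one : g 1 = 1 := by
    change (TensorAlgebra.lift C ((LinearMap.llcomp C R R R P).comp
      ((LinearMap.mul C R).comp φ.toLinearMap)) (1 : TensorAlgebra C A)) (1 : R) = 1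
    simp
  have g_cons (a : A) (t : MixShuffle C lam A) :
      g (MixShuffle.cons lam A a t) = P (φ a * g t) := by
    change (TensorAlgebra.lift C ((LinearMap.llcomp C R R R P).comp
      ((LinearMap.mul C R).comp φ.toLinearMap))
        (TensorAlgebra.ι C a * (show TensorAlgebra C A from t))) (1 : R) = _
    rw [map_mul, Module.End.mul_apply, TensorAlgebra.lift_ι_apply]
    rfl
  have g_mul (s t : MixShuffle C lam A) : g (s * t) = g s * g t := by
    induction s using MixShuffle.induction generalizing t with
    | one => rw [one_mul, g_one, one_mul]
    | add s s' hs hs' => rw [add_mul, map_add, map_add, add_mul, hs, hs']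
    | smul c s hs => rw [smul_mul_assoc, map_smul, map_smul, smul_mul_assoc, hs]
    | hcons a s hs =>
      induction t using MixShuffle.induction with
      | one => rw [mul_one, g_one, mul_one]
      | add t t' ht ht' => rw [mul_add, map_add, map_add, mul_add, ht, ht']
      | smul c t ht => rw [mul_smul_comm, map_smul, map_smul, mul_smul_comm, ht]
      | hcons b t ht =>
        have h1 : φ a * (g s * P (φ b * g t)) = φ a * g s * P (φ b * g t) := by ring
        have h2 : φ b * (P (φ a * g s) * g t) = φ b * g t * P (φ a * g s) := by ring
        have h3 : φ a * φ b * (g s * g t) = φ a * g s * (φ b * g t) := by ring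
        rw [MixShuffle.cons_mul_cons, mul_comm t, map_add, map_add, map_smul, g_cons, g_cons,
          g_cons, hs, hs, ht, g_cons, g_cons, map_mul φ, h1, h2, h3, hP]
  let G : MixShuffle C lam A →ₐ[C] R := AlgHom.ofLinearMap g g_one g_mul
  have G_cons (a : A) (t : MixShuffle C lam A) :
      G (MixShuffle.cons lam A a t) = P (φ a * G t) := g_cons a t
  refine ⟨Algebra.TensorProduct.lift φ G fun _ _ => Commute.all _ _, ⟨fun x => ?_, fun a => ?_⟩,
    fun f ⟨hf, hf'⟩ => ?_⟩
  · induction x using TensorProduct.induction_on with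
    | zero => simp
    | add x y hx hy => simp only [map_add, hx, hy]
    | tmul a t => simp [shaOp_tmul, G_cons]
  · simp
  · refine Algebra.TensorProduct.ext' fun a t => ?_
    have key : f (1 ⊗ₜ t) = G t := by
      induction t using MixShuffle.induction with
      | one => rw [map_one G, ← map_one f]; rfl
      | add s t hs ht => rw [TensorProduct.tmul_add, map_add, map_add, hs, ht]
      | smul c t ht => rw [TensorProduct.tmul_smul, map_smul, map_smul, ht]
      | hcons b t ht =>
        have : (b ⊗ₜ[C] t : Sha lam A) = (b ⊗ₜ 1) * (1 ⊗ₜ t) := by simp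
        rw [← shaOp_tmul, hf, this, map_mul, hf', ht, G_cons]
    have : (a ⊗ₜ[C] t : Sha lam A) = (a ⊗ₜ 1) * (1 ⊗ₜ t) := by simp
    rw [this, map_mul, hf', key, ← this]
    simp

end Sha

end

end ShuffleBaxter

/-!
Suppose first that `A` is free over a domain `C` of characteristic zero, and order the words in a
well-ordered basis of `A` by length and then lexicographically. The leading word of the product of
two words is their lexicographically largest shuffle, with a positive integer as its coefficient:
all shuffles have the same length and positive integer multiplicities, while the words produced by
the weight term are shorter. The largest shuffle is strictly increasing in each of the two words, so
the leading coefficient of `s ⋆ t` is a positive integer times those of `s` and `t`, hence nonzero.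

For a domain `A` with fraction field `K`, the algebra `Ш(A) = A ⊗ T(A)` maps to
`K ⊗ T(A) ≃ T(K ⊗ A)`, the mixable shuffle algebra of an algebra over a field, and this map is
injective exactly when `Ш(A)` is torsion-free over `A`. Flatness of `A` over `C` suffices for that,
since it passes to `T(A)` and then to `A ⊗ T(A)` as an `A`-module.
-/

namespace ShuffleBaxter

open Module

section Words

variable {I : Type*}

/-- The shortlex order on words (by length, then lexicographically), encoded as an injection into
a lexicographic product, since `List I` itself carries the lexicographic order. -/
def shortlex (w : List I) : ℕ ×ₗ List I :=
  toLex (w.length, w)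

theorem shortlex_injective : Function.Injective (shortlex : List I → ℕ ×ₗ List I) :=
  fun _ _ h => congrArg (fun p => (ofLex p).2) h

variable [LinearOrder I]

theorem shortlex_lt_iff {u v : List I} :
    shortlex u < shortlex v ↔ u.length < v.length ∨ u.length = v.length ∧ u < v := by
  simp only [shortlex, Prod.Lex.toLex_lt_toLex]

/-- The lexicographically largest shuffle of two words. -/
def maxShuffle : List I → List I → List I
  | [], v => v
  | i :: u, [] => i :: u
  | i :: u, j :: v => max (i :: maxShuffle u (j :: v)) (j :: maxShuffle (i :: u) v)
termination_by u v => u.length + v.length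

theorem maxShuffle_nil_right (u : List I) : maxShuffle u [] = u := by
  cases u <;> simp only [maxShuffle]

theorem maxShuffle_comm (u v : List I) : maxShuffle u v = maxShuffle v u := by
  induction u generalizing v with
  | nil => rw [maxShuffle_nil_right, maxShuffle]
  | cons i u ihu =>
    induction v with
    | nil => rw [maxShuffle_nil_right, maxShuffle]
    | cons j v ihv => rw [maxShuffle, maxShuffle, ihu, ihv, max_comm]

theorem length_maxShuffle (u v : List I) : (maxShuffle u v).length = u.length + v.length := by
  induction u generalizing v with
  | nil => simp [maxShuffle]
  | cons i u ihu =>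
    induction v with
    | nil => simp [maxShuffle]
    | cons j v ihv =>
      rw [maxShuffle]
      rcases max_choice (i :: maxShuffle u (j :: v)) (j :: maxShuffle (i :: u) v) with h | h <;>
        rw [h] <;> simp [ihu, ihv] <;> omega

theorem maxShuffle_lt_maxShuffle_left {u u' : List I} (hlen : u.length = u'.length) (h : u < u')
    (v : List I) : maxShuffle u v < maxShuffle u' v := by
  induction u generalizing u' v with
  | nil =>
    obtain rfl := List.length_eq_zero_iff.1 hlen.symm
    exact absurd h (lt_irrefl _)
  | cons i u ihu =>
    obtain ⟨i', u', rfl⟩ := List.exists_cons_of_length_eq_add_one hlen.symm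
    have hlen' : u.length = u'.length := by simpa using hlen
    induction v with
    | nil => simpa only [maxShuffle_nil_right] using h
    | cons j v ihv =>
      rw [maxShuffle, maxShuffle]
      refine max_lt_max ?_ (List.cons_lt_cons_iff.2 (Or.inr ⟨rfl, ihv⟩))
      rw [List.cons_lt_cons_iff] at h ⊢
      exact h.imp_right fun ⟨heq, hlt⟩ => ⟨heq, ihu hlen' hlt _⟩

theorem shortlex_maxShuffle_lt_left {u u' : List I} (h : shortlex u < shortlex u') (v : List I) :
    shortlex (maxShuffle u v) < shortlex (maxShuffle u' v) := by
  simp only [shortlex_lt_iff, length_maxShuffle, add_lt_add_iff_right, add_left_inj] at h ⊢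
  exact h.imp_right fun ⟨hlen, hlt⟩ => ⟨hlen, maxShuffle_lt_maxShuffle_left hlen hlt v⟩

theorem shortlex_maxShuffle_lt_right (u : List I) {v v' : List I} (h : shortlex v < shortlex v') :
    shortlex (maxShuffle u v) < shortlex (maxShuffle u v') := by
  rw [maxShuffle_comm u, maxShuffle_comm u]
  exact shortlex_maxShuffle_lt_left h u

theorem shortlex_maxShuffle_lt {u u' v v' : List I} (hu : shortlex u ≤ shortlex u')
    (hv : shortlex v ≤ shortlex v') (hne : u ≠ u' ∨ v ≠ v') :
    shortlex (maxShuffle u v) < shortlex (maxShuffle u' v') := by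
  rcases hu.lt_or_eq with hlt | heq
  · refine (shortlex_maxShuffle_lt_left hlt v).trans_le ?_
    rcases hv.lt_or_eq with hlt' | heq'
    · exact (shortlex_maxShuffle_lt_right u' hlt').le
    · rw [shortlex_injective heq']
  · obtain rfl := shortlex_injective heq
    have hne' : v ≠ v' := hne.resolve_left fun h => h rfl
    exact shortlex_maxShuffle_lt_right u (hv.lt_of_ne (shortlex_injective.ne hne'))

end Words

section WordBasis

variable {F : Type*} [CommSemiring F] {M : Type*} [AddCommMonoid M] [Module F M] {I : Type*}
  (b : Basis I F M)

/-- The basis of the tensor algebra formed by the words in a basis, indexed by lists. -/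
noncomputable def wordBasis : Basis (List I) F (TensorAlgebra F M) :=
  b.tensorAlgebra.reindex FreeMonoid.toList

theorem wordBasis_nil : wordBasis b [] = 1 := by
  simp [wordBasis, Basis.tensorAlgebra, FreeAlgebra.basisFreeMonoid,
    FreeAlgebra.equivMonoidAlgebraFreeMonoid]

theorem wordBasis_cons (i : I) (w : List I) :
    wordBasis b (i :: w) = TensorAlgebra.ι F (b i) * wordBasis b w := by
  simp [wordBasis, Basis.tensorAlgebra, FreeAlgebra.basisFreeMonoid,
    FreeAlgebra.equivMonoidAlgebraFreeMonoid]

theorem wordBasis_repr_ι_mul_nil (x : M) (t : TensorAlgebra F M) :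
    (wordBasis b).repr (TensorAlgebra.ι F x * t) [] = 0 := by
  have : ((LinearMap.mul F _).comp (TensorAlgebra.ι F)).compr₂ ((wordBasis b).coord []) = 0 := by
    refine b.ext fun i => (wordBasis b).ext fun w => ?_
    simp [← wordBasis_cons]
  exact congr($this x t)

theorem wordBasis_repr_ι_mul_cons (x : M) (t : TensorAlgebra F M) (j : I) (w : List I) :
    (wordBasis b).repr (TensorAlgebra.ι F x * t) (j :: w) =
      b.repr x j * (wordBasis b).repr t w := by
  have : ((LinearMap.mul F _).comp (TensorAlgebra.ι F)).compr₂ ((wordBasis b).coord (j :: w)) =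
      (LinearMap.mul F F).compl₁₂ (b.coord j) ((wordBasis b).coord w) := by
    classical
    refine b.ext fun i => (wordBasis b).ext fun v => ?_
    simp [← wordBasis_cons, Finsupp.single_apply, ← ite_and, and_comm]
  exact congr($this x t)

end WordBasis

section LeadingWord

variable {F : Type*} [CommSemiring F] {M : Type*} [AddCommMonoid M] [Module F M] {I : Type*}
  [LinearOrder I] {b : Basis I F M} {s t : TensorAlgebra F M} {u v w : List I}

/-- `w` is the leading word of `t` for the shortlex order on the words in the basis `b`, and its
coefficient is a positive integer, so that in characteristic zero leading terms of equal words
cannot cancel. -/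
def HasLeadingWord (b : Basis I F M) (t : TensorAlgebra F M) (w : List I) : Prop :=
  (∃ n : ℕ, 0 < n ∧ (wordBasis b).repr t w = n) ∧
    ∀ w', shortlex w < shortlex w' → (wordBasis b).repr t w' = 0

theorem hasLeadingWord_wordBasis (b : Basis I F M) (w : List I) :
    HasLeadingWord b (wordBasis b w) w := by
  refine ⟨⟨1, one_pos, by simp⟩, fun w' h => ?_⟩
  rw [Basis.repr_self, Finsupp.single_eq_of_ne fun e => h.ne (congrArg shortlex e.symm)]

theorem HasLeadingWord.repr_ne_zero [CharZero F] (h : HasLeadingWord b t w) :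
    (wordBasis b).repr t w ≠ 0 := by
  obtain ⟨⟨n, hn, hrepr⟩, -⟩ := h
  rw [hrepr]
  exact Nat.cast_ne_zero.2 hn.ne'

theorem HasLeadingWord.repr_eq_zero_of_length_lt (h : HasLeadingWord b t w)
    (hlen : w.length < v.length) : (wordBasis b).repr t v = 0 :=
  h.2 v (shortlex_lt_iff.2 (Or.inl hlen))

theorem HasLeadingWord.ι_mul (h : HasLeadingWord b t w) (i : I) :
    HasLeadingWord b (TensorAlgebra.ι F (b i) * t) (i :: w) := by
  obtain ⟨⟨n, hn, hrepr⟩, hlarger⟩ := h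
  refine ⟨⟨n, hn, by simp [wordBasis_repr_ι_mul_cons, hrepr]⟩, ?_⟩
  rintro (_ | ⟨j, v⟩) hlt
  · exact wordBasis_repr_ι_mul_nil b _ _
  rw [wordBasis_repr_ι_mul_cons]
  by_cases hij : i = j
  · rw [hlarger v, mul_zero]
    simpa [shortlex_lt_iff, List.cons_lt_cons_iff, hij] using hlt
  · rw [Basis.repr_self, Finsupp.single_eq_of_ne' hij, zero_mul]

theorem HasLeadingWord.repr_ι_mul_eq_zero_of_length_lt (h : HasLeadingWord b t w) (x : M)
    (hlen : w.length + 1 < v.length) : (wordBasis b).repr (TensorAlgebra.ι F x * t) v = 0 := by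
  rcases v with _ | ⟨j, v⟩
  · exact wordBasis_repr_ι_mul_nil b x t
  · rw [wordBasis_repr_ι_mul_cons, h.repr_eq_zero_of_length_lt (by simpa using hlen), mul_zero]

theorem HasLeadingWord.add_of_repr_eq_nat (ht : HasLeadingWord b t w) (n : ℕ)
    (hs : (wordBasis b).repr s w = n)
    (hlarger : ∀ w', shortlex w < shortlex w' → (wordBasis b).repr s w' = 0) :
    HasLeadingWord b (s + t) w := by
  obtain ⟨⟨m, hm, hrepr⟩, hlarger'⟩ := ht
  refine ⟨⟨n + m, by omega, ?_⟩, fun w' h => ?_⟩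
  · rw [map_add, Finsupp.add_apply, hs, hrepr, Nat.cast_add]
  · rw [map_add, Finsupp.add_apply, hlarger w' h, hlarger' w' h, add_zero]

theorem HasLeadingWord.add_of_le (hs : HasLeadingWord b s u) (ht : HasLeadingWord b t v)
    (hle : shortlex u ≤ shortlex v) : HasLeadingWord b (s + t) v := by
  obtain ⟨n, hn⟩ : ∃ n : ℕ, (wordBasis b).repr s v = n := by
    rcases hle.lt_or_eq with hlt | heq
    · exact ⟨0, by rw [hs.2 v hlt, Nat.cast_zero]⟩
    · obtain ⟨⟨n, -, hn⟩, -⟩ := hs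
      exact ⟨n, shortlex_injective heq ▸ hn⟩
  exact ht.add_of_repr_eq_nat n hn fun w' h => hs.2 w' (hle.trans_lt h)

theorem HasLeadingWord.add_max (hs : HasLeadingWord b s u) (ht : HasLeadingWord b t v)
    (hlen : u.length = v.length) : HasLeadingWord b (s + t) (max u v) := by
  rcases le_total u v with hle | hle
  · rw [max_eq_right hle]
    exact hs.add_of_le ht (Prod.Lex.toLex_le_toLex.2 (Or.inr ⟨hlen, hle⟩))
  · rw [max_eq_left hle, add_comm]
    exact ht.add_of_le hs (Prod.Lex.toLex_le_toLex.2 (Or.inr ⟨hlen.symm, hle⟩))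

theorem HasLeadingWord.add_shorter (ht : HasLeadingWord b t w)
    (hs : ∀ v : List I, w.length ≤ v.length → (wordBasis b).repr s v = 0) :
    HasLeadingWord b (t + s) w := by
  rw [add_comm]
  refine ht.add_of_repr_eq_nat 0 (by rw [hs w le_rfl, Nat.cast_zero]) fun v hlt => hs v ?_
  rcases shortlex_lt_iff.1 hlt with hlen | ⟨hlen, -⟩
  exacts [hlen.le, hlen.le]

theorem exists_max_word (b : Basis I F M) (ht : t ≠ 0) :
    ∃ w, (wordBasis b).repr t w ≠ 0 ∧
      ∀ v, (wordBasis b).repr t v ≠ 0 → shortlex v ≤ shortlex w := by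
  have hne : ((wordBasis b).repr t).support.Nonempty := by
    simpa [Finsupp.support_nonempty_iff] using ht
  simpa only [Finsupp.mem_support_iff] using Finset.exists_max_image _ shortlex hne

end LeadingWord

section NoZeroDivisors

theorem bilin_apply_eq_repr_mul_repr_mul {R M N ι κ : Type*} [CommSemiring R] [AddCommMonoid M]
    [Module R M] [AddCommMonoid N] [Module R N] (b : Basis ι R M) (c : Basis κ R N)
    (β : M →ₗ[R] N →ₗ[R] R) {x : M} {y : N} {i : ι} {j : κ}
    (h : ∀ i' j', b.repr x i' ≠ 0 → c.repr y j' ≠ 0 → i' ≠ i ∨ j' ≠ j → β (b i') (c j') = 0) :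
    β x y = b.repr x i * c.repr y j * β (b i) (c j) := by
  rw [← LinearMap.sum_repr_mul_repr_mul b c x y, Finsupp.sum, Finset.sum_eq_single i,
    Finsupp.sum, Finset.sum_eq_single j]
  · rw [smul_eq_mul, smul_eq_mul, mul_assoc]
  · intro j' hj' hne
    by_cases hi : b.repr x i = 0
    · rw [hi, zero_smul]
    · rw [h i j' hi (Finsupp.mem_support_iff.1 hj') (Or.inr hne), smul_zero, smul_zero]
  · intro hj
    rw [Finsupp.notMem_support_iff.1 hj, zero_smul, smul_zero]
  · intro i' hi' hne
    refine Finset.sum_eq_zero fun j' hj' => ?_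
    simp only [h i' j' (Finsupp.mem_support_iff.1 hi') (Finsupp.mem_support_iff.1 hj')
      (Or.inl hne), smul_zero]
  · intro hi
    simp only [Finsupp.notMem_support_iff.1 hi, zero_smul, Finsupp.sum, Finset.sum_const_zero]

variable {F : Type*} [CommRing F] {B : Type*} [CommRing B] [Algebra F B] (lam : F)

theorem hasLeadingWord_mixMul {I : Type*} [LinearOrder I] (b : Basis I F B) (u v : List I) :
    HasLeadingWord b (mixMul lam (wordBasis b u) (wordBasis b v)) (maxShuffle u v) := by
  induction u generalizing v with
  | nil =>
    rw [wordBasis_nil, mixMul_one_left, maxShuffle]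
    exact hasLeadingWord_wordBasis b v
  | cons i u ihu =>
    induction v with
    | nil =>
      rw [wordBasis_nil, mixMul_one_right, maxShuffle_nil_right]
      exact hasLeadingWord_wordBasis b (i :: u)
    | cons j v ihv =>
      have hu := (ihu (j :: v)).ι_mul i
      have hv := ihv.ι_mul j
      have hlen : (i :: maxShuffle u (j :: v)).length = (j :: maxShuffle (i :: u) v).length := by
        simp only [List.length_cons, length_maxShuffle]
        omega
      rw [wordBasis_cons] at hu hv ⊢
      rw [wordBasis_cons b j v, ← cons_apply, ← cons_apply, mixMul_cons_cons]
      refine HasLeadingWord.add_shorter ?_ fun w hw => ?_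
      · rw [maxShuffle]
        exact hu.add_max hv hlen
      · have hshorter : (maxShuffle u v).length + 1 < w.length := by
          simp only [List.length_cons, length_maxShuffle] at hw ⊢
          omega
        rw [map_smul, Finsupp.smul_apply, cons_apply,
          (ihu v).repr_ι_mul_eq_zero_of_length_lt _ hshorter, smul_zero]

theorem mixMul_ne_zero [IsDomain F] [CharZero F] [Module.Free F B] {s t : TensorAlgebra F B}
    (hs : s ≠ 0) (ht : t ≠ 0) : mixMul lam s t ≠ 0 := by
  obtain ⟨⟨I, b⟩⟩ := Module.Free.exists_basis (R := F) (M := B)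
  classical
  let _ : LinearOrder I := linearOrderOfSTO WellOrderingRel
  obtain ⟨u, hu, hu_max⟩ := exists_max_word b hs
  obtain ⟨v, hv, hv_max⟩ := exists_max_word b ht
  have hcoeff := bilin_apply_eq_repr_mul_repr_mul (wordBasis b) (wordBasis b)
    ((mixMul lam).compr₂ ((wordBasis b).coord (maxShuffle u v))) (x := s) (y := t) (i := u) (j := v)
    fun u' v' hu' hv' hne => (hasLeadingWord_mixMul lam b u' v').2 _
      (shortlex_maxShuffle_lt (hu_max u' hu') (hv_max v' hv') hne)
  intro hzero
  refine mul_ne_zero (mul_ne_zero hu hv) (hasLeadingWord_mixMul lam b u v).repr_ne_zero ?_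
  simpa [hzero] using hcoeff.symm

instance [IsDomain F] [CharZero F] [Module.Free F B] : NoZeroDivisors (MixShuffle F lam B) where
  eq_zero_or_eq_zero_of_mul_eq_zero {s t} h := by
    by_contra! hne
    exact mixMul_ne_zero lam hne.1 hne.2 h

end NoZeroDivisors

section BaseChange

section Module

variable (C : Type*) [CommSemiring C] (E : Type*) [CommSemiring E] [Algebra C E] (M : Type*)
  [AddCommMonoid M] [Module C M]

/-- The base change isomorphism `E ⊗ T(M) ≃ T(E ⊗ M)`. -/
noncomputable def tensorAlgebraBaseChange :
    E ⊗[C] TensorAlgebra C M ≃ₐ[E] TensorAlgebra E (E ⊗[C] M) :=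
  AlgEquiv.ofAlgHom
    (Algebra.TensorProduct.lift (Algebra.ofId E _)
      (TensorAlgebra.lift C
        (((TensorAlgebra.ι E).restrictScalars C).comp (TensorProduct.mk C E M 1)))
      fun r _ => by rw [Algebra.ofId_apply]; exact Algebra.commute_algebraMap_left r _)
    (TensorAlgebra.lift E ((TensorAlgebra.ι C).baseChange E))
    (by ext; simp)
    (by ext; simp)

variable {C M}

theorem tensorAlgebraBaseChange_ι_mul (m : M) (t : TensorAlgebra C M) :
    tensorAlgebraBaseChange C E M (1 ⊗ₜ (TensorAlgebra.ι C m * t)) =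
      TensorAlgebra.ι E (1 ⊗ₜ m) * tensorAlgebraBaseChange C E M (1 ⊗ₜ t) := by
  simp [tensorAlgebraBaseChange]

theorem tensorAlgebraBaseChange_one_tmul_smul (c : C) (t : TensorAlgebra C M) :
    tensorAlgebraBaseChange C E M (1 ⊗ₜ (c • t)) =
      algebraMap C E c • tensorAlgebraBaseChange C E M (1 ⊗ₜ t) := by
  rw [← map_smul, TensorProduct.tmul_smul, algebraMap_smul]

theorem tensorAlgebraBaseChange_tmul (r : E) (t : TensorAlgebra C M) :
    tensorAlgebraBaseChange C E M (r ⊗ₜ t) = r • tensorAlgebraBaseChange C E M (1 ⊗ₜ t) := by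
  rw [← map_smul, TensorProduct.smul_tmul', smul_eq_mul, mul_one]

end Module

variable {C : Type*} [CommRing C] (E : Type*) [CommRing E] [Algebra C E] {A : Type*} [CommRing A]
  [Algebra C A] (lam : C)

theorem tensorAlgebraBaseChange_mixMul (s t : TensorAlgebra C A) :
    tensorAlgebraBaseChange C E A (1 ⊗ₜ mixMul lam s t) =
      mixMul (algebraMap C E lam) (tensorAlgebraBaseChange C E A (1 ⊗ₜ s))
        (tensorAlgebraBaseChange C E A (1 ⊗ₜ t)) := by
  have map_one' : tensorAlgebraBaseChange C E A (1 ⊗ₜ 1) = 1 := map_one _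
  induction s using word_induction generalizing t with
  | one => rw [mixMul_one_left, map_one', mixMul_one_left]
  | add s s' hs hs' => simp only [map_add, TensorProduct.tmul_add, LinearMap.add_apply, hs, hs']
  | smul c s hs =>
    simp only [tensorAlgebraBaseChange_one_tmul_smul, map_smul (mixMul _), LinearMap.smul_apply, hs]
  | hcons a s hs =>
    induction t using word_induction with
    | one => rw [mixMul_one_right, map_one', mixMul_one_right]
    | add t t' ht ht' => simp only [map_add, TensorProduct.tmul_add, ht, ht']
    | smul c t ht => simp only [tensorAlgebraBaseChange_one_tmul_smul, map_smul, ht]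
    | hcons a' t ht =>
      have map_cons (a : A) (t : TensorAlgebra C A) :
          tensorAlgebraBaseChange C E A (1 ⊗ₜ cons a t) =
            cons (1 ⊗ₜ a) (tensorAlgebraBaseChange C E A (1 ⊗ₜ t)) :=
        tensorAlgebraBaseChange_ι_mul E a t
      simp only [mixMul_cons_cons, TensorProduct.tmul_add, map_add,
        tensorAlgebraBaseChange_one_tmul_smul, map_cons, hs, ht,
        Algebra.TensorProduct.tmul_mul_tmul, one_mul]

theorem tensorAlgebraBaseChange_tmul_mixMul (r r' : E) (s t : TensorAlgebra C A) :
    tensorAlgebraBaseChange C E A ((r * r') ⊗ₜ mixMul lam s t) =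
      mixMul (algebraMap C E lam) (tensorAlgebraBaseChange C E A (r ⊗ₜ s))
        (tensorAlgebraBaseChange C E A (r' ⊗ₜ t)) := by
  rw [tensorAlgebraBaseChange_tmul, tensorAlgebraBaseChange_mixMul,
    tensorAlgebraBaseChange_tmul E r, tensorAlgebraBaseChange_tmul E r', map_smul, map_smul,
    LinearMap.smul_apply, smul_smul, mul_comm]

variable (A)

/-- The base change isomorphism for mixable shuffle algebras. -/
noncomputable def mixShuffleBaseChange :
    E ⊗[C] MixShuffle C lam A ≃ₐ[E] MixShuffle E (algebraMap C E lam) (E ⊗[C] A) :=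
  Algebra.TensorProduct.algEquivOfLinearEquivTensorProduct
    (tensorAlgebraBaseChange C E A).toLinearEquiv
    (tensorAlgebraBaseChange_tmul_mixMul E lam)
    (map_one (tensorAlgebraBaseChange C E A))

end BaseChange

section Flat

variable {C : Type*} [CommSemiring C] (M : Type*) [AddCommMonoid M] [Module C M] [Module.Flat C M]

instance flat_tensorPower (n : ℕ) : Module.Flat C (⨂[C]^n M) := by
  induction n with
  | zero => exact Module.Flat.of_linearEquiv TensorPower.algebraMap₀.symm
  | succ n _ =>
    have : Module.Flat C (⨂[C]^1 M) :=
      Module.Flat.of_linearEquiv (PiTensorProduct.subsingletonEquiv (s := fun _ : Fin 1 => M) 0)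
    exact Module.Flat.of_linearEquiv (TensorPower.mulEquiv (n := n) (m := 1)).symm

instance flat_tensorAlgebra : Module.Flat C (TensorAlgebra C M) :=
  Module.Flat.of_linearEquiv TensorAlgebra.equivDirectSum.toLinearEquiv

end Flat

section Domain

variable {C : Type*} [CommRing C] (lam : C) (A : Type*) [CommRing A] [Algebra C A]

instance [Module.Flat C A] : Module.Flat C (MixShuffle C lam A) :=
  flat_tensorAlgebra (C := C) A

theorem algebraMap_sha_injective : Function.Injective (algebraMap A (Sha lam A)) := by
  -- The zero operator is a Baxter operator, so freeness yields a retraction of `A → Ш(A)`.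
  have hzero : IsBaxterOperator lam (0 : A →ₗ[C] A) := fun x y => by simp
  obtain ⟨f, ⟨-, hf⟩, -⟩ := sha_free lam 0 hzero (AlgHom.id C A)
  exact Function.LeftInverse.injective hf

theorem isDomain_sha_of_isTorsionFree [IsDomain A] [CharZero A]
    [Module.IsTorsionFree A (Sha lam A)] : IsDomain (Sha lam A) := by
  let K := FractionRing A
  have : Nontrivial (Sha lam A) := (algebraMap_sha_injective lam A).nontrivial
  have : CharZero K := charZero_of_injective_algebraMap (IsFractionRing.injective A K)
  have : NoZeroDivisors (K ⊗[C] MixShuffle C lam A) :=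
    (mixShuffleBaseChange K A lam).injective.noZeroDivisors _ (map_zero _) (map_mul _)
  let f : Sha lam A →ₐ[C] K ⊗[C] MixShuffle C lam A :=
    Algebra.TensorProduct.map (IsScalarTower.toAlgHom C A K) (AlgHom.id C _)
  have hf : Function.Injective f :=
    (IsLocalizedModule.injective_iff_isRegular (nonZeroDivisors A)
      (TensorProduct.AlgebraTensorModule.rTensor C (MixShuffle C lam A)
        (Algebra.linearMap A K))).2 fun c => Module.IsTorsionFree.isSMulRegular
          (isRegular_iff_mem_nonZeroDivisors.2 c.2)
  have := hf.noZeroDivisors f (map_zero f) (map_mul f)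
  exact NoZeroDivisors.to_isDomain _

end Domain

end ShuffleBaxter

theorem mainTheorem5_general {C : Type*} [CommRing C] (lam : C) (A : Type*) [CommRing A]
    [CharZero A] [Algebra C A] :
    IsDomain (ShuffleBaxter.Sha lam A) ↔
      IsDomain A ∧ Module.IsTorsionFree A (ShuffleBaxter.Sha lam A) := by
  constructor
  · intro
    have hinj := ShuffleBaxter.algebraMap_sha_injective lam A
    have : IsDomain A := hinj.isDomain (algebraMap A (ShuffleBaxter.Sha lam A))
    have : FaithfulSMul A (ShuffleBaxter.Sha lam A) :=
      (faithfulSMul_iff_algebraMap_injective _ _).2 hinj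
    exact ⟨inferInstance, inferInstance⟩
  · rintro ⟨_, _⟩
    exact ShuffleBaxter.isDomain_sha_of_isTorsionFree lam A

namespace ShuffleBaxter

section CharZero

variable {C : Type*} [CommRing C] [CharZero C] (lam : C) (A : Type*) [CommRing A] [Algebra C A]

theorem isDomain_sha_of_flat [IsDomain C] [IsDomain A] [Module.Flat C A] :
    IsDomain (Sha lam A) := by
  have : CharZero A := charZero_of_injective_algebraMap (FaithfulSMul.algebraMap_injective C A)
  have : Module.Flat A (Sha lam A) :=
    inferInstanceAs (Module.Flat A (A ⊗[C] MixShuffle C lam A))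
  exact (mainTheorem5_general lam A).2 ⟨inferInstance, inferInstance⟩

theorem isDomain_sha_iff_isTorsionFree [IsDedekindDomain C]
    (hinj : Function.Injective (algebraMap C A)) :
    IsDomain (Sha lam A) ↔ IsDomain A ∧ Module.IsTorsionFree C A := by
  constructor
  · intro h
    have : CharZero A := charZero_of_injective_algebraMap hinj
    have : IsDomain A := ((mainTheorem5_general lam A).1 h).1
    have : FaithfulSMul C A := (faithfulSMul_iff_algebraMap_injective C A).2 hinj
    exact ⟨inferInstance, inferInstance⟩
  · rintro ⟨_, _⟩
    exact isDomain_sha_of_flat lam A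

end CharZero

end ShuffleBaxter

theorem mainTheorem5 {C : Type*} [CommRing C] [IsDomain C] [CharZero C] (lam : C) :
    (∀ (A : Type*) [CommRing A] [IsDomain A] [Algebra C A], Module.Flat C A →
        IsDomain (ShuffleBaxter.Sha lam A)) ∧
    (∀ X : Type*, IsDomain (ShuffleBaxter.Sha lam (MvPolynomial X C))) ∧
    (IsDedekindDomain C → ∀ (A : Type*) [CommRing A] [Algebra C A],
        Function.Injective (algebraMap C A) →
          (IsDomain (ShuffleBaxter.Sha lam A) ↔ IsDomain A ∧ Module.IsTorsionFree C A)) :=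
  ⟨fun A _ _ _ _ => ShuffleBaxter.isDomain_sha_of_flat lam A,
    fun X => ShuffleBaxter.isDomain_sha_of_flat lam (MvPolynomial X C),
    fun _ A _ _ hinj => ShuffleBaxter.isDomain_sha_iff_isTorsionFree lam A hinj⟩
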